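/- All vector spaces are over $\mathbb{C}$. Let $k\ge 2$, let $V$ be a $k$-dimensional vector space, and let $\mathfrak{Jord}_k\subset \mathrm{Hom}(V\otimes V,V)$ be the set of all Jordan multiplications on $V$, i.e. bilinear commutative multiplications satisfying $(x^2y)x=x^2(yx)$. Fixing a basis of $V$ identifies $\mathrm{Hom}(V\otimes V,V)$ with $\mathbb{C}^{k^3}$ through the structure constants; a subset is Zariski-closed if it is defined by a set of polynomial equations in the structure constants, and $\mathfrak{Jord}_k$ carries the induced topology. The group $GL(V)$ acts by $(g*\mu)(x,y)=g\,\mu(g^{-1}x,g^{-1}y)$; a Jordan algebra represented by $\mu\in\mathfrak{Jord}_k$ is called rigid in $\mathfrak{Jord}_k$ if the orbit $GL(V)*\mu$ is open in $\mathfrak{Jord}_k$. For a Jordan algebra $\mathfrak{J}$, let $Z^2(\mathfrak{J},\mathfrak{J})$ be the space of bilinear maps $h:\mathfrak{J}\times\mathfrak{J}\to\mathfrak{J}$ such that, for all $a,b\in\mathfrak{J}$, $h(a,b)=h(b,a)$ and $$(h(a,a)b)a+h(a^2,b)a+h(a^2b,a)-a^2h(b,a)-h(a,a)(ba)-h(a^2,ba)=0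 .$$ For every linear map $\varphi:\mathfrak{J}\to\mathfrak{J}$ the map $d\varphi(a,b)=\varphi(a)b+a\varphi(b)-\varphi(ab)$ lies in $Z^2(\mathfrak{J},\mathfrak{J})$, and the second cohomology group $H^2(\mathfrak{J},\mathfrak{J})$ of $\mathfrak{J}$ with coefficients in itself is the quotient of $Z^2(\mathfrak{J},\mathfrak{J})$ by the subspace of all maps $d\varphi$. Theorem. For every $k\ge 2$, let $\mathfrak{J}_k$ be the $k$-dimensional algebra with basis $e,n_1,\dots,n_{k-1}$ and multiplication $e^2=e$, $e n_i=n_i e=\tfrac12 n_i$, $n_in_j=0$ for $1\le i,j\le k-1$. Then $\mathfrak{J}_k$ is a Jordan algebra, $H^2(\mathfrak{J}_k,\mathfrak{J}_k)=0$, and $\mathfrak{J}_k$ is rigid in $\mathfrak{Jord}_k$. -/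

import Mathlib

set_option maxSynthPendingDepth 3

/-- The space `Hom(V ⊗ V, V)` of bilinear multiplications on a complex vector space `V`. -/
abbrev BilMul (V : Type*) [AddCommGroup V] [Module ℂ V] := V →ₗ[ℂ] V →ₗ[ℂ] V

/-- The set of all Jordan multiplications on `V`: commutative, with `(x² y) x = x² (y x)`. -/
def jordanVariety (V : Type*) [AddCommGroup V] [Module ℂ V] : Set (BilMul V) :=
  {μ | (∀ x y, μ x y = μ y x) ∧ ∀ x y, μ (μ (μ x x) y) x = μ (μ x x) (μ y x)}

/-- The structure constants of `μ` in the basis `c`: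
`μ (c i) (c j) = ∑ l, structureConstants c μ (i, j, l) • c l`. -/
noncomputable def structureConstants {V : Type*} [AddCommGroup V] [Module ℂ V] {k : ℕ}
    (c : Module.Basis (Fin k) ℂ V) (μ : BilMul V) : Fin k × Fin k × Fin k → ℂ :=
  fun t => c.repr (μ (c t.1) (c t.2.1)) t.2.2

/-- Zariski-closed sets of multiplications: those cut out by a set of polynomial equations in the
structure constants. -/
def IsZariskiClosed {V : Type*} [AddCommGroup V] [Module ℂ V] {k : ℕ}
    (c : Module.Basis (Fin k) ℂ V) (S : Set (BilMul V)) : Prop :=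
  ∃ P : Set (MvPolynomial (Fin k × Fin k × Fin k) ℂ),
    S = {μ | ∀ p ∈ P, MvPolynomial.eval (structureConstants c μ) p = 0}

/-- The action of `GL(V)` on multiplications: `(g * μ)(x, y) = g (μ (g⁻¹ x, g⁻¹ y))`. -/
def glAct {V : Type*} [AddCommGroup V] [Module ℂ V] (g : V ≃ₗ[ℂ] V) (μ : BilMul V) : BilMul V :=
  LinearMap.mk₂ ℂ (fun x y => g (μ (g.symm x) (g.symm y)))
    (by simp) (by simp) (by simp) (by simp)

/-- The `GL(V)`-orbit of `μ`. -/
def glOrbit {V : Type*} [AddCommGroup V] [Module ℂ V] (μ : BilMul V) : Set (BilMul V) :=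
  Set.range fun g : V ≃ₗ[ℂ] V => glAct g μ

/-- `μ` is rigid: it is a Jordan multiplication, and its orbit is open in the variety of Jordan
multiplications on `V` for the topology induced by the Zariski topology. -/
def IsRigid {V : Type*} [AddCommGroup V] [Module ℂ V] {k : ℕ}
    (c : Module.Basis (Fin k) ℂ V) (μ : BilMul V) : Prop :=
  μ ∈ jordanVariety V ∧
    ∃ C : Set (BilMul V), IsZariskiClosed c C ∧ glOrbit μ = jordanVariety V \ C

/-- The space of 2-cocycles of the algebra `(V, μ)` with coefficients in itself: the symmetric
bilinear maps `h` with
`(h(a,a) b) a + h(a²,b) a + h(a² b,a) - a² h(b,a) - h(a,a)(b a) - h(a²,b a) = 0`. -/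
def jordanCocycles {V : Type*} [AddCommGroup V] [Module ℂ V] (μ : BilMul V) :
    Submodule ℂ (BilMul V) where
  carrier := {h | (∀ a b, h a b = h b a) ∧
    ∀ a b, μ (μ (h a a) b) a + μ (h (μ a a) b) a + h (μ (μ a a) b) a
      - μ (μ a a) (h b a) - μ (h a a) (μ b a) - h (μ a a) (μ b a) = 0}
  zero_mem' := by simp
  add_mem' := by
    rintro h₁ h₂ ⟨s₁, z₁⟩ ⟨s₂, z₂⟩
    refine ⟨fun a b => by simp [s₁ a b, s₂ a b], fun a b => ?_⟩
    have e := congrArg₂ (· + ·) (z₁ a b) (z₂ a b)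
    simp only [add_zero] at e
    rw [← e]
    simp only [LinearMap.add_apply, map_add]
    abel
  smul_mem' := by
    rintro r h ⟨s, z⟩
    refine ⟨fun a b => by simp [s a b], fun a b => ?_⟩
    have e := congrArg (r • ·) (z a b)
    simp only [smul_zero] at e
    rw [← e]
    simp only [LinearMap.smul_apply, map_smul]
    module

/-- The coboundary `(dφ)(a, b) = φ(a) b + a φ(b) - φ(a b)` of a linear map `φ`. -/
def jordanCoboundary {V : Type*} [AddCommGroup V] [Module ℂ V] (μ : BilMul V) :
    (V →ₗ[ℂ] V) →ₗ[ℂ] BilMul V where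
  toFun φ := LinearMap.mk₂ ℂ (fun a b => μ (φ a) b + μ a (φ b) - φ (μ a b))
    (by intros; simp only [map_add, LinearMap.add_apply]; abel)
    (by intros; simp only [map_smul, LinearMap.smul_apply]; module)
    (by intros; simp only [map_add]; abel)
    (by intros; simp only [map_smul]; module)
  map_add' φ ψ := by
    ext a b
    simp only [LinearMap.mk₂_apply, map_add, LinearMap.add_apply]
    abel
  map_smul' r φ := by
    ext a b
    simp only [LinearMap.mk₂_apply, map_smul, LinearMap.smul_apply, RingHom.id_apply]
    module

/-- Over a Jordan multiplication every coboundary is a cocycle. -/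
theorem jordanCoboundary_range_le {V : Type*} [AddCommGroup V] [Module ℂ V] (μ : BilMul V)
    (hμ : μ ∈ jordanVariety V) : LinearMap.range (jordanCoboundary μ) ≤ jordanCocycles μ := by
  rintro _ ⟨φ, rfl⟩
  obtain ⟨comm, jord⟩ := hμ
  refine ⟨fun a b => ?_, fun a b => ?_⟩
  · simp only [jordanCoboundary, LinearMap.coe_mk, AddHom.coe_mk, LinearMap.mk₂_apply]
    rw [comm (φ a) b, comm a (φ b), comm a b]
    abel
  · have lin : ∀ c : V, (2 : ℂ) • (μ (μ (μ a c) b) a) + μ (μ (μ a a) b) c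
        - (2 : ℂ) • (μ (μ a c) (μ b a)) - μ (μ a a) (μ b c) = 0 := by
      intro c
      have h1 := jord (a + c) b
      have h2 := jord (a - c) b
      have h3 := jord c b
      simp only [map_add, map_sub, LinearMap.add_apply, LinearMap.sub_apply, comm c a] at h1 h2
      linear_combination (norm := module) (1 / 2 : ℂ) • h1 - (1 / 2 : ℂ) • h2 - h3
    have l := lin (φ a)
    have p := jord a (φ b)
    have q := congrArg φ (jord a b)
    simp only [jordanCoboundary, LinearMap.coe_mk, AddHom.coe_mk, LinearMap.mk₂_apply,
      map_add, map_sub, LinearMap.add_apply, LinearMap.sub_apply, comm (φ a) a]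
    linear_combination (norm := module) l + p - q

/-- The second cohomology group `H²(J, J)` of the Jordan algebra `J = (V, μ)` with coefficients in
itself: cocycles modulo coboundaries. -/
abbrev JordanH2 {V : Type*} [AddCommGroup V] [Module ℂ V] (μ : BilMul V) :=
  jordanCocycles μ ⧸ (LinearMap.range (jordanCoboundary μ)).submoduleOf (jordanCocycles μ)

/-- The multiplication with `e² = e`, `e nᵢ = nᵢ e = ½ nᵢ`, `nᵢ nⱼ = 0`, where `e` is the
vector of index `0` of the basis `b`, and the `nᵢ` are its other vectors. -/
noncomputable def marginalMul {V : Type*} [AddCommGroup V] [Module ℂ V] {k : ℕ}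
    (b : Module.Basis (Fin k) ℂ V) : BilMul V :=
  b.constr ℂ fun i => b.constr ℂ fun j =>
    if (i : ℕ) = 0 then (if (j : ℕ) = 0 then b j else (1 / 2 : ℂ) • b j)
    else (if (j : ℕ) = 0 then (1 / 2 : ℂ) • b i else 0)

/-! With `l` the coordinate of `e`, the product is `½ (l(x) y + l(y) x)`. Such products form a
linear space `W` of Jordan multiplications, and those with `l ≠ 0` form one `GL(V)`-orbit. Cocycles
at a nonzero point of `W` lie in `W` (`exists_functionalMul_of_cocycle`), and all of `W` consists of
coboundaries there, so `H² = 0`. For rigidity, let `π` be a linear projection onto `W`. If `μ` is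
Jordan, subtracting the Jordan identities of `μ` and `π μ` gives a linear system for `μ - π μ` with
coefficients polynomial in `μ`. At a nonzero point of `W` it is the cocycle system, whose only
symmetric solution killed by `π` is `0`. Nonvanishing of a determinant keeps it injective nearby,
forcing `μ = π μ ∈ W`. -/

/-- The commutative multiplication `(x, y) ↦ ½ (l(x) y + l(y) x)` attached to a linear
functional `l`. -/
noncomputable def functionalMul {V : Type*} [AddCommGroup V] [Module ℂ V] :
    (V →ₗ[ℂ] ℂ) →ₗ[ℂ] BilMul V where
  toFun l := LinearMap.mk₂ ℂ (fun x y => (1 / 2 : ℂ) • (l x • y + l y • x))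
    (by intros; simp only [map_add]; module) (by intros; simp only [map_smul, smul_eq_mul]; module)
    (by intros; simp only [map_add]; module) (by intros; simp only [map_smul, smul_eq_mul]; module)
  map_add' l m := by
    ext x y
    simp only [LinearMap.mk₂_apply, LinearMap.add_apply]
    module
  map_smul' r l := by
    ext x y
    simp only [LinearMap.mk₂_apply, LinearMap.smul_apply, RingHom.id_apply, smul_eq_mul]
    module

/-! ### Multiplications attached to functionals: orbit and cohomology -/

section FunctionalMul

variable {V : Type*} [AddCommGroup V] [Module ℂ V]

theorem functionalMul_apply (l : V →ₗ[ℂ] ℂ) (x y : V) :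
    functionalMul l x y = (1 / 2 : ℂ) • (l x • y + l y • x) := rfl

theorem functionalMul_self (l : V →ₗ[ℂ] ℂ) (x : V) : functionalMul l x x = l x • x := by
  rw [functionalMul_apply]
  module

theorem functionalMul_injective :
    Function.Injective (functionalMul : (V →ₗ[ℂ] ℂ) →ₗ[ℂ] BilMul V) := by
  rw [injective_iff_map_eq_zero]
  intro l hl
  ext x
  have h : l x • x = 0 := by rw [← functionalMul_self, hl]; rfl
  rcases smul_eq_zero.mp h with h | h
  · simpa using h
  · simp [h]

theorem functionalMul_mem_jordanVariety (l : V →ₗ[ℂ] ℂ) :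
    functionalMul l ∈ jordanVariety V := by
  refine ⟨fun x y => ?_, fun x y => ?_⟩
  · simp only [functionalMul_apply]
    module
  · simp only [functionalMul_apply, map_smul, map_add, LinearMap.smul_apply,
      LinearMap.add_apply]
    module

theorem marginalMul_eq_functionalMul {k : ℕ} (hk : 0 < k) (b : Module.Basis (Fin k) ℂ V) :
    marginalMul b = functionalMul (b.coord ⟨0, hk⟩) := by
  refine b.ext fun i => b.ext fun j => ?_
  simp only [marginalMul, Module.Basis.constr_basis, functionalMul_apply, Module.Basis.coord_apply,
    Module.Basis.repr_self, Finsupp.single_apply, Fin.ext_iff]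
  split_ifs with hi hj hj
  · rw [show i = j from Fin.ext (hi.trans hj.symm)]
    module
  all_goals module

/-- The general linear group acts transitively on nonzero functionals. -/
theorem exists_linearEquiv_comp_eq [FiniteDimensional ℂ V] {l m : V →ₗ[ℂ] ℂ} (hl : l ≠ 0)
    (hm : m ≠ 0) : ∃ g : V ≃ₗ[ℂ] V, ∀ x, l (g x) = m x := by
  obtain ⟨y, hly, hmy⟩ : ∃ y, l y ≠ 0 ∧ m y ≠ 0 := by
    obtain ⟨u, hu⟩ := DFunLike.ne_iff.mp hl
    obtain ⟨v, hv⟩ := DFunLike.ne_iff.mp hm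
    simp only [LinearMap.zero_apply] at hu hv
    by_cases h1 : m u = 0
    · by_cases h2 : l v = 0
      · exact ⟨u + v, by simpa [h2] using hu, by simpa [h1] using hv⟩
      · exact ⟨v, h2, hv⟩
    · exact ⟨u, hu, h1⟩
  -- Moving `x` along `y` changes `l x` into `m x`; a kernel vector is a multiple of `y` killed by
  -- `m`, hence zero.
  let f : V →ₗ[ℂ] V := LinearMap.id + ((l y)⁻¹ • (m - l)).smulRight y
  have hf : ∀ x, f x = x + ((l y)⁻¹ * (m x - l x)) • y := fun x => rfl
  have hlf : ∀ x, l (f x) = m x := by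
    intro x
    rw [hf, map_add, map_smul, smul_eq_mul]
    field_simp
    ring
  have inj : Function.Injective f := by
    rw [injective_iff_map_eq_zero]
    intro x hx
    have hmx : m x = 0 := by rw [← hlf, hx, map_zero]
    have hxy : x = ((l y)⁻¹ * l x) • y := by
      rw [hf, hmx] at hx
      linear_combination (norm := module) hx
    rw [hxy, map_smul, smul_eq_mul] at hmx
    rw [hxy, (mul_eq_zero.mp hmx).resolve_right hmy, zero_smul]
  exact ⟨LinearEquiv.ofInjectiveEndo f inj, hlf⟩

theorem glAct_functionalMul (g : V ≃ₗ[ℂ] V) (l : V →ₗ[ℂ] ℂ) :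
    glAct g (functionalMul l) = functionalMul (l ∘ₗ g.symm.toLinearMap) := by
  ext x y
  simp [glAct, functionalMul_apply]

theorem mem_glOrbit_functionalMul [FiniteDimensional ℂ V] {l : V →ₗ[ℂ] ℂ} (hl : l ≠ 0)
    {ν : BilMul V} : ν ∈ glOrbit (functionalMul l) ↔ ∃ m ≠ 0, ν = functionalMul m := by
  constructor
  · rintro ⟨g, rfl⟩
    refine ⟨_, fun h => hl ?_, glAct_functionalMul g l⟩
    ext x
    simpa using DFunLike.congr_fun h (g x)
  · rintro ⟨m, hm, rfl⟩
    obtain ⟨g, hg⟩ := exists_linearEquiv_comp_eq hl hm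
    refine ⟨g.symm, ?_⟩
    simp only [glAct_functionalMul]
    congr 1
    ext x
    exact hg x

/-- A cocycle of `functionalMul l` satisfies `l(a) h(a, a) = l(h(a, a)) a`. -/
theorem cocycle_diagonal {l : V →ₗ[ℂ] ℂ} (hl : l ≠ 0) {h : BilMul V}
    (hh : h ∈ jordanCocycles (functionalMul l)) (a : V) : l a • h a a = l (h a a) • a := by
  obtain ⟨b, hb⟩ := DFunLike.ne_iff.mp hl
  obtain ⟨symm, coc⟩ := hh
  -- Here `a² = l(a) a`; all terms in `h a b` cancel, leaving `-¼ l(b)` times the wanted identity.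
  have e := coc a b
  simp only [functionalMul_apply, map_smul, map_add, LinearMap.smul_apply, LinearMap.add_apply,
    symm b a] at e
  refine smul_right_injective V hb ?_
  simp only
  linear_combination (norm := module) (-4 : ℂ) • e

/-- Polarising the diagonal identity and inserting `y` with `l y = 1` expresses `h` through `l ∘ h`,
and `l ∘ h` vanishes on pairs from `ker l`. -/
theorem exists_functionalMul_of_cocycle {l : V →ₗ[ℂ] ℂ} (hl : l ≠ 0) {h : BilMul V}
    (hh : h ∈ jordanCocycles (functionalMul l)) : ∃ m, h = functionalMul m := by
  obtain ⟨y, hy⟩ : ∃ y, l y = 1 := by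
    obtain ⟨b, hb⟩ := DFunLike.ne_iff.mp hl
    exact ⟨(l b)⁻¹ • b, by simpa using inv_mul_cancel₀ hb⟩
  have symm := hh.1
  have D := cocycle_diagonal hl hh
  have polar : ∀ a b c, l a • h b c + l b • h a c + l c • h a b
      = l (h b c) • a + l (h a c) • b + l (h a b) • c := by
    intro a b c
    have e1 := D (a + b + c)
    have e2 := D (a + b)
    have e3 := D (a + c)
    have e4 := D (b + c)
    simp only [map_add, LinearMap.add_apply, symm b a, symm c a, symm c b] at e1 e2 e3 e4
    linear_combination (norm := module)
      (1 / 2 : ℂ) • (e1 - e2 - e3 - e4 + D a + D b + D c)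
  have ker_diag : ∀ a, l a = 0 → l (h a a) = 0 := by
    intro a ha
    have e := D a
    rw [ha, zero_smul, eq_comm, smul_eq_zero] at e
    rcases e with e | e
    · exact e
    · simp [e]
  have ker : ∀ a b, l a = 0 → l b = 0 → l (h a b) = 0 := by
    intro a b ha hb
    have e := ker_diag (a + b) (by simp [ha, hb])
    simp only [map_add, LinearMap.add_apply, symm b a, ker_diag a ha, ker_diag b hb] at e
    linear_combination (1 / 2 : ℂ) * e
  have hyy : h y y = l (h y y) • y := by simpa [hy] using D y
  -- This `m` is forced: apply `l` to `h y a = ½ (m(y) a + m(a) y)`, with `m y = l (h y y)`.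
  refine ⟨(2 : ℂ) • (l ∘ₗ h y) - l (h y y) • l, ?_⟩
  ext a b
  have r := ker (a - l a • y) (b - l b • y) (by simp [hy]) (by simp [hy])
  have pa := polar a y y
  have pb := polar b y y
  have pab := polar a b y
  simp only [map_sub, map_smul, LinearMap.sub_apply, LinearMap.smul_apply, smul_eq_mul] at r
  simp only [hy, one_smul, symm a y, symm b y] at pa pb pab r
  simp only [functionalMul_apply, LinearMap.sub_apply, LinearMap.smul_apply,
    LinearMap.comp_apply, smul_eq_mul]
  have r' := congrArg (· • y) r
  simp only [zero_smul] at r'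
  linear_combination (norm := module)
    pab - (l a / 2) • pb - (l b / 2) • pa + r' + (l a * l b) • hyy

theorem jordanCoboundary_functionalMul (l : V →ₗ[ℂ] ℂ) (φ : V →ₗ[ℂ] V) :
    jordanCoboundary (functionalMul l) φ = functionalMul (l ∘ₗ φ) := by
  ext a b
  simp only [jordanCoboundary, LinearMap.coe_mk, AddHom.coe_mk, LinearMap.mk₂_apply,
    functionalMul_apply, map_smul, map_add, LinearMap.comp_apply]
  module

theorem jordanCocycles_le_range {l : V →ₗ[ℂ] ℂ} (hl : l ≠ 0) :
    jordanCocycles (functionalMul l) ≤ LinearMap.range (jordanCoboundary (functionalMul l)) := by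
  intro h hh
  obtain ⟨m, rfl⟩ := exists_functionalMul_of_cocycle hl hh
  obtain ⟨b, hb⟩ := DFunLike.ne_iff.mp hl
  -- `l` is `1` on `(l b)⁻¹ • b`, so `l ∘ φ = m`.
  refine ⟨m.smulRight ((l b)⁻¹ • b), ?_⟩
  rw [jordanCoboundary_functionalMul]
  congr 1
  ext x
  simp [inv_mul_cancel₀ hb]

end FunctionalMul

/-! ### Polynomial functions and Zariski-open subsets -/

section StructureConstants

variable {V : Type*} [AddCommGroup V] [Module ℂ V] {k : ℕ} (c : Module.Basis (Fin k) ℂ V)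

/-- Functions on `BilMul V` which are polynomial in the structure constants. -/
def IsPolynomialFunction (f : BilMul V → ℂ) : Prop :=
  ∃ p : MvPolynomial (Fin k × Fin k × Fin k) ℂ,
    ∀ μ, f μ = MvPolynomial.eval (structureConstants c μ) p

variable {c}

theorem IsPolynomialFunction.const (r : ℂ) : IsPolynomialFunction c fun _ => r :=
  ⟨MvPolynomial.C r, fun μ => by simp⟩

theorem IsPolynomialFunction.add {f g : BilMul V → ℂ} (hf : IsPolynomialFunction c f)
    (hg : IsPolynomialFunction c g) : IsPolynomialFunction c fun μ => f μ + g μ := by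
  obtain ⟨p, hp⟩ := hf
  obtain ⟨q, hq⟩ := hg
  exact ⟨p + q, fun μ => by simp [hp, hq]⟩

theorem IsPolynomialFunction.mul {f g : BilMul V → ℂ} (hf : IsPolynomialFunction c f)
    (hg : IsPolynomialFunction c g) : IsPolynomialFunction c fun μ => f μ * g μ := by
  obtain ⟨p, hp⟩ := hf
  obtain ⟨q, hq⟩ := hg
  exact ⟨p * q, fun μ => by simp [hp, hq]⟩

theorem IsPolynomialFunction.sum {ι : Type*} (s : Finset ι) {f : ι → BilMul V → ℂ}
    (hf : ∀ i, IsPolynomialFunction c (f i)) :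
    IsPolynomialFunction c fun μ => ∑ i ∈ s, f i μ := by
  choose p hp using hf
  exact ⟨∑ i ∈ s, p i, fun μ => by simp [hp]⟩

theorem IsPolynomialFunction.det {ι : Type*} [Fintype ι] [DecidableEq ι]
    {M : BilMul V → Matrix ι ι ℂ} (hM : ∀ i j, IsPolynomialFunction c fun μ => M μ i j) :
    IsPolynomialFunction c fun μ => (M μ).det := by
  choose p hp using hM
  refine ⟨(Matrix.of p).det, fun μ => ?_⟩
  have hM : M μ = (MvPolynomial.eval (structureConstants c μ)).mapMatrix (Matrix.of p) := by
    ext i j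
    simp [hp]
  simp only [hM, RingHom.map_det]

variable (c)

theorem exists_sum_structureConstants :
    ∃ E : Fin k × Fin k × Fin k → BilMul V, ∀ μ, μ = ∑ t, structureConstants c μ t • E t := by
  refine ⟨fun t => c.constr ℂ fun i => c.constr ℂ fun j =>
    if i = t.1 ∧ j = t.2.1 then c t.2.2 else 0, fun μ => c.ext fun i => c.ext fun j => ?_⟩
  simp only [LinearMap.sum_apply, LinearMap.smul_apply, Module.Basis.constr_basis,
    Fintype.sum_prod_type, structureConstants, ite_and, smul_ite, smul_zero,
    Finset.sum_ite_irrel, Finset.sum_ite_eq, Finset.mem_univ, if_true, Finset.sum_const_zero]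
  exact (c.sum_repr _).symm

variable {c}

theorem IsPolynomialFunction.linear (f : BilMul V →ₗ[ℂ] ℂ) : IsPolynomialFunction c f := by
  obtain ⟨E, hE⟩ := exists_sum_structureConstants c
  refine ⟨∑ t, MvPolynomial.X t * MvPolynomial.C (f (E t)), fun μ => ?_⟩
  conv_lhs => rw [hE μ]
  simp

theorem IsPolynomialFunction.bilinear (f : BilMul V →ₗ[ℂ] BilMul V →ₗ[ℂ] ℂ) :
    IsPolynomialFunction c fun μ => f μ μ := by
  obtain ⟨E, hE⟩ := exists_sum_structureConstants c
  have : (fun μ => f μ μ) = fun μ => ∑ t, structureConstants c μ t * f (E t) μ := by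
    funext μ
    conv_lhs => enter [1]; rw [hE μ]
    simp
  rw [this]
  exact .sum _ fun t => .mul ⟨MvPolynomial.X t, fun μ => by simp⟩ (.linear _)

/-- A subset `O` of the Jordan variety is relatively open if each of its points has a polynomial
function nonzero there which is nonzero, among Jordan multiplications, only on `O`. -/
theorem exists_isZariskiClosed_diff {J O : Set (BilMul V)} (hO : O ⊆ J)
    (h : ∀ μ ∈ O, ∃ f, IsPolynomialFunction c f ∧ f μ ≠ 0 ∧ ∀ ν ∈ J, f ν ≠ 0 → ν ∈ O) :
    ∃ C, IsZariskiClosed c C ∧ O = J \ C := by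
  -- `C` is the Zariski closure of `J \ O`.
  refine ⟨_, ⟨{p | ∀ ν ∈ J \ O, MvPolynomial.eval (structureConstants c ν) p = 0}, rfl⟩, ?_⟩
  ext μ
  constructor
  · intro hμ
    refine ⟨hO hμ, fun hC => ?_⟩
    obtain ⟨f, ⟨p, hp⟩, hf, hJ⟩ := h μ hμ
    refine hf ((hp μ).trans (hC p fun ν hν => ?_))
    rw [← hp]
    by_contra hne
    exact hν.2 (hJ ν hν.1 hne)
  · rintro ⟨hJ, hC⟩
    by_contra hμ
    exact hC fun p hp => hp μ ⟨hJ, hμ⟩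

end StructureConstants

/-! ### Openness of the orbit -/

section Rigidity

variable {V : Type*} [AddCommGroup V] [Module ℂ V]

/-- The polarised Jordan expression, linear in each of three multiplications. -/
def jordanPolar (μ₁ μ₂ μ₃ : BilMul V) (a b : V) : V :=
  μ₁ (μ₂ (μ₃ a a) b) a - μ₁ (μ₂ a a) (μ₃ b a)

/-- For a linear endomorphism `π` of `BilMul V`, the map whose value `D μ μ` at `μ - π μ` is the
difference of the Jordan expressions of `μ` and `π μ`. -/
def jordanDifference (π : BilMul V →ₗ[ℂ] BilMul V) :
    BilMul V →ₗ[ℂ] BilMul V →ₗ[ℂ] BilMul V →ₗ[ℂ] (V → V → V) :=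
  LinearMap.mk₂ ℂ (fun μ ν =>
    { toFun := fun h a b =>
        jordanPolar h μ ν a b + jordanPolar (π μ) h ν a b + jordanPolar (π μ) (π ν) h a b
      map_add' := by
        intros; funext a b
        simp only [jordanPolar, map_add, LinearMap.add_apply, Pi.add_apply]; abel
      map_smul' := by
        intros; funext a b
        simp only [jordanPolar, map_smul, LinearMap.smul_apply, Pi.smul_apply, RingHom.id_apply]
        module })
    (by
      intros; ext h a b
      simp only [jordanPolar, map_add, LinearMap.add_apply, Pi.add_apply, LinearMap.coe_mk,
        AddHom.coe_mk]
      abel)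
    (by
      intros; ext h a b
      simp only [jordanPolar, map_smul, LinearMap.smul_apply, Pi.smul_apply, LinearMap.coe_mk,
        AddHom.coe_mk]
      module)
    (by
      intros; ext h a b
      simp only [jordanPolar, map_add, LinearMap.add_apply, Pi.add_apply, LinearMap.coe_mk,
        AddHom.coe_mk]
      abel)
    (by
      intros; ext h a b
      simp only [jordanPolar, map_smul, LinearMap.smul_apply, Pi.smul_apply, LinearMap.coe_mk,
        AddHom.coe_mk]
      module)

theorem jordanDifference_apply (π : BilMul V →ₗ[ℂ] BilMul V) (μ ν h : BilMul V) (a b : V) :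
    jordanDifference π μ ν h a b =
      jordanPolar h μ ν a b + jordanPolar (π μ) h ν a b + jordanPolar (π μ) (π ν) h a b := rfl

/-- The three summands telescope, replacing `μ` by `π μ` one slot at a time. -/
theorem jordanDifference_sub (π : BilMul V →ₗ[ℂ] BilMul V) {μ : BilMul V}
    (hμ : μ ∈ jordanVariety V) (hπ : π μ ∈ jordanVariety V) :
    jordanDifference π μ μ (μ - π μ) = 0 := by
  funext a b
  have e₁ := hμ.2 a b
  have e₂ := hπ.2 a b
  simp only [jordanDifference_apply, jordanPolar, map_sub, LinearMap.sub_apply, Pi.zero_apply]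
  linear_combination (norm := module) e₁ - e₂

/-- When `π μ = μ`, the three summands are the derivative of the Jordan expression at `μ` along `h`.
-/
theorem mem_jordanCocycles_of_jordanDifference (π : BilMul V →ₗ[ℂ] BilMul V) {μ h : BilMul V}
    (hπ : π μ = μ) (symm : h = h.flip) (hh : jordanDifference π μ μ h = 0) :
    h ∈ jordanCocycles μ := by
  refine ⟨fun a b => congrArg (fun f : BilMul V => f a b) symm, fun a b => ?_⟩
  have e := congrFun (congrFun hh a) b
  simp only [jordanDifference_apply, jordanPolar, hπ, Pi.zero_apply] at e
  linear_combination (norm := module) e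

theorem exists_polynomialFunction_functionalMul {k : ℕ} (c : Module.Basis (Fin k) ℂ V)
    {l : V →ₗ[ℂ] ℂ} (hl : l ≠ 0) :
    ∃ f, IsPolynomialFunction c f ∧ f (functionalMul l) ≠ 0 ∧
      ∀ μ ∈ jordanVariety V, f μ ≠ 0 → ∃ m ≠ 0, μ = functionalMul m := by
  have := Module.Finite.of_basis c
  obtain ⟨ρ, hρ⟩ := LinearMap.exists_leftInverse_of_injective
    (functionalMul : (V →ₗ[ℂ] ℂ) →ₗ[ℂ] BilMul V) (LinearMap.ker_eq_bot.mpr functionalMul_injective)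
  have hρ' : ∀ m, ρ (functionalMul m) = m := fun m => DFunLike.congr_fun hρ m
  obtain ⟨y, hy⟩ := DFunLike.ne_iff.mp hl
  let π : BilMul V →ₗ[ℂ] BilMul V := functionalMul ∘ₗ ρ
  have hπ : ∀ μ, π μ = functionalMul (ρ μ) := fun μ => rfl
  let S : BilMul V →ₗ[ℂ] BilMul V :=
    LinearMap.id - (LinearMap.lflip : BilMul V ≃ₗ[ℂ] BilMul V).toLinearMap
  have hS : ∀ h, S h = h - h.flip := fun h => rfl
  -- The first component removes `W`, the second imposes symmetry, the third is the linearised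
  -- Jordan identity.
  let G (μ : BilMul V) : BilMul V →ₗ[ℂ] (V →ₗ[ℂ] ℂ) × BilMul V × (V → V → V) :=
    ρ.prod (S.prod (jordanDifference π μ μ))
  have inj : LinearMap.ker (G (functionalMul l)) = ⊥ := by
    rw [LinearMap.ker_eq_bot']
    intro h hh
    simp only [G, LinearMap.prod_apply, Function.prod_apply, Prod.mk_eq_zero] at hh
    obtain ⟨h1, h2, h3⟩ := hh
    obtain ⟨m, rfl⟩ := exists_functionalMul_of_cocycle hl
      (mem_jordanCocycles_of_jordanDifference π (by rw [hπ, hρ']) (sub_eq_zero.mp h2) h3)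
    rw [hρ'] at h1
    rw [h1, map_zero]
  -- `B` is fixed at the base point, so `det (B ∘ G μ)` is polynomial in `μ` and equals `1` there.
  obtain ⟨B, hB⟩ := LinearMap.exists_leftInverse_of_injective _ inj
  let β := Module.finBasis ℂ (BilMul V)
  let M (μ : BilMul V) := LinearMap.toMatrix β β (B ∘ₗ G μ)
  -- The factor `ρ μ y` excludes the zero functional.
  refine ⟨fun μ => (M μ).det * ρ μ y, .mul (.det fun i j => ?_)
    (.linear (LinearMap.applyₗ y ∘ₗ ρ)), ?_, ?_⟩
  -- Each entry is a constant plus a quadratic form in `μ`.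
  · have e : ∀ μ, M μ i j = β.coord i (B (ρ (β j), S (β j), 0))
        + (β.coord i ∘ₗ B ∘ₗ LinearMap.inr ℂ _ _ ∘ₗ LinearMap.inr ℂ _ _)
          (jordanDifference π μ μ (β j)) := by
      intro μ
      simp only [M, G, LinearMap.toMatrix_apply, LinearMap.comp_apply, LinearMap.prod_apply,
        Function.prod_apply, LinearMap.inr_apply, Module.Basis.coord_apply, ← Finsupp.add_apply,
        ← map_add, Prod.mk_add_mk, add_zero, zero_add]
    simp only [e]
    exact .add (.const _) (.bilinear ((jordanDifference π).compr₂
      ((β.coord i ∘ₗ B ∘ₗ LinearMap.inr ℂ _ _ ∘ₗ LinearMap.inr ℂ _ _) ∘ₗ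
        LinearMap.applyₗ (β j))))
  · simp only [M, hB, LinearMap.toMatrix_id, Matrix.det_one, one_mul, hρ']
    exact hy
  · intro μ hμ hf
    have hdet := left_ne_zero_of_mul hf
    simp only [M, LinearMap.det_toMatrix] at hdet
    have hw := functionalMul_mem_jordanVariety (ρ μ)
    have hG : G μ (μ - π μ) = 0 := by
      simp only [G, LinearMap.prod_apply, Function.prod_apply, Prod.mk_eq_zero]
      refine ⟨by rw [map_sub, hπ, hρ', sub_self], ?_, jordanDifference_sub π hμ hw⟩
      ext a b
      simp only [hS, hπ, LinearMap.sub_apply, LinearMap.flip_apply, LinearMap.zero_apply,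
        hμ.1 b a, hw.1 b a, sub_self]
    have hker : LinearMap.ker (B ∘ₗ G μ) = ⊥ := by
      by_contra hne
      exact hdet (LinearMap.det_eq_zero_iff_ker_ne_bot.mpr hne)
    have hz := LinearMap.ker_eq_bot'.mp hker (μ - π μ) (by simp [hG])
    refine ⟨ρ μ, fun h0 => hf ?_, sub_eq_zero.mp hz⟩
    simp [h0]

theorem isRigid_functionalMul {k : ℕ} (c : Module.Basis (Fin k) ℂ V) {l : V →ₗ[ℂ] ℂ}
    (hl : l ≠ 0) : IsRigid c (functionalMul l) := by
  have := Module.Finite.of_basis c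
  refine ⟨functionalMul_mem_jordanVariety l, exists_isZariskiClosed_diff ?_ ?_⟩
  · intro μ hμ
    obtain ⟨m, -, rfl⟩ := (mem_glOrbit_functionalMul hl).mp hμ
    exact functionalMul_mem_jordanVariety m
  · intro μ hμ
    obtain ⟨m, hm, rfl⟩ := (mem_glOrbit_functionalMul hl).mp hμ
    obtain ⟨f, hf, hne, h⟩ := exists_polynomialFunction_functionalMul c hm
    exact ⟨f, hf, hne, fun ν hν hfν => (mem_glOrbit_functionalMul hl).mpr (h ν hν hfν)⟩

end Rigidity

theorem mainTheorem3 {V : Type*} [AddCommGroup V] [Module ℂ V] (k : ℕ) (hk : 2 ≤ k)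
    (c b : Module.Basis (Fin k) ℂ V) :
    Subsingleton (JordanH2 (marginalMul b)) ∧ IsRigid c (marginalMul b) := by
  have hk0 : 0 < k := by omega
  have hl : b.coord ⟨0, hk0⟩ ≠ 0 := fun h => by
    simpa using DFunLike.congr_fun h (b ⟨0, hk0⟩)
  rw [marginalMul_eq_functionalMul hk0]
  refine ⟨?_, isRigid_functionalMul c hl⟩
  rw [Submodule.Quotient.subsingleton_iff, Submodule.submoduleOf,
    Submodule.comap_subtype_eq_top]
  exact jordanCocycles_le_range hl
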